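/- Let $N\in\mathbb N$, let $J=(J_{j,k})_{1\le j,k\le N}$ be a symmetric real matrix with $J_{j,k}\ge 0$ for all $j,k$, and let $\lambda=(\lambda_1,\dots,\lambda_N)\in[0,\infty)^N$. A \emph{partition function} is a function $\mathcal P:\mathbb C\to\mathbb C$ of one of the following two forms: (i) (Ising model) $\mathcal P(z)=\sum_{x\in\{-1,1\}^N}e^{z\,\lambda\cdot x}\,\mu(x)$, where $\mu(x)=K\exp\big(\sum_{j,k=1}^N J_{j,k}x_jx_k\big)$ is a probability measure on $\{-1,1\}^N$, $K>0$ being the normalizing constant; (ii) $\mathcal P(z)=\int_{\mathbb R^N}e^{z\,\lambda\cdot x}\,\mu_\beta(dx)$, where $\beta\ge 0$ and $\mu_\beta(dx)=K\exp\big(\beta\sum_{j,k=1}^N J_{j,k}x_jx_k\big)\prod_{k=1}^N\mu_0(dx_k)$ is a probability measure on $\mathbb R^N$, $K>0$ being the normalizing constant and $\mu_0$ a symmetric probability measure on $\mathbb R$ with $\int_{\mathbb R}e^{bx^2}\mu_0(dx)<\infty$ for all $b\in\mathbb R$. A partition function has the \emph{Lee--Yang property} if it is an entire function all of whose zeros are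 purely imaginary. Let $\mathbb{D}_L$ be the set of functions $F:\mathbb R\to\mathbb C$ that are continuous, bounded and positive-definite with $F(0)=1$ (equivalently, characteristic functions of real random variables), and that are the restriction to $\mathbb R$ of an even entire function $\varphi$ with $\varphi(0)=1$ in the Laguerre--P\'olya class, i.e. $\varphi$ is the locally uniform limit on $\mathbb C$ of a sequence of polynomials with real coefficients and only real zeros. Then a partition function $\mathcal P$ has the Lee--Yang property if and only if the function $t\mapsto\mathcal P(it)$, $t\in\mathbb R$, belongs to $\mathbb D_L$. -/

import Mathlib

open MeasureTheory Filter Topology Polynomial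

/-- The Laguerre-Pólya class: entire functions that are locally uniform limits on `ℂ` of sequences
of polynomials with real coefficients all of whose complex zeros are real. -/
def LaguerrePolya : Set (ℂ → ℂ) :=
  {φ | Differentiable ℂ φ ∧
    ∃ p : ℕ → ℝ[X],
      (∀ n, ∀ z : ℂ, aeval z (p n) = 0 → z.im = 0) ∧
      TendstoLocallyUniformly (fun n (z : ℂ) => aeval z (p n)) φ atTop}

/-- The even functions in the Laguerre-Pólya class, normalized to be `1` at the origin. -/
def EvenLaguerrePolya : Set (ℂ → ℂ) :=
  {φ | φ ∈ LaguerrePolya ∧ (∀ z, φ (-z) = φ z) ∧ φ 0 = 1}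

/-- Positive definiteness of a complex-valued function on the real line: all the Hermitian forms
`∑ c_j * conj c_k * F (t_j - t_k)` take nonnegative real values. -/
def IsPosDefFun (F : ℝ → ℂ) : Prop :=
  ∀ (n : ℕ) (t : Fin n → ℝ) (c : Fin n → ℂ),
    0 ≤ (∑ j, ∑ k, c j * (starRingEnd ℂ) (c k) * F (t j - t k)).re ∧
      (∑ j, ∑ k, c j * (starRingEnd ℂ) (c k) * F (t j - t k)).im = 0

/-- Continuous bounded positive definite functions on `ℝ`, normalized to be `1` at the origin. -/
def NormalizedPosDef : Set (ℝ → ℂ) :=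
  {F | Continuous F ∧ (∃ C : ℝ, ∀ t, ‖F t‖ ≤ C) ∧ IsPosDefFun F ∧ F 0 = 1}

/-- The Lukacs class `𝔻_L`: continuous bounded normalized positive definite functions on `ℝ` that
are restrictions to `ℝ` of even normalized functions of the Laguerre-Pólya class. -/
def LukacsClass : Set (ℝ → ℂ) :=
  {F | F ∈ NormalizedPosDef ∧ ∃ φ ∈ EvenLaguerrePolya, ∀ t : ℝ, φ (t : ℂ) = F t}

/-- The interaction energy `∑_{j,k} J_{j,k} x_j x_k`. -/
def interaction {N : ℕ} (J : Fin N → Fin N → ℝ) (x : Fin N → ℝ) : ℝ :=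
  ∑ j, ∑ k, J j k * x j * x k

/-- A spin configuration in `{-1,1}^N`, seen as a vector in `ℝ^N`. -/
def spinVec {N : ℕ} (s : Fin N → ℤˣ) : Fin N → ℝ := fun j => ((s j : ℤ) : ℝ)

/-- The weight of a configuration under the Ising probability measure
`K exp (∑_{j,k} J_{j,k} x_j x_k)` on `{-1,1}^N`, where `K` is the normalizing constant. -/
noncomputable def isingWeight {N : ℕ} (J : Fin N → Fin N → ℝ) (s : Fin N → ℤˣ) : ℝ :=
  (∑ s' : Fin N → ℤˣ, Real.exp (interaction J (spinVec s')))⁻¹ *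
    Real.exp (interaction J (spinVec s))

/-- The partition function `z ↦ ∑_x exp (z l·x) μ(x)` of the Ising model. -/
noncomputable def isingPartition {N : ℕ} (J : Fin N → Fin N → ℝ) (l : Fin N → ℝ) (z : ℂ) : ℂ :=
  ∑ s : Fin N → ℤˣ,
    Complex.exp (z * ((∑ j, l j * spinVec s j : ℝ) : ℂ)) * (isingWeight J s : ℂ)

/-- The probability measure `K exp (β ∑_{j,k} J_{j,k} x_j x_k) ∏_k μ₀(dx_k)` on `ℝ^N`, where `K` is
the normalizing constant. -/
noncomputable def gibbsMeasure {N : ℕ} (μ₀ : Measure ℝ) (β : ℝ) (J : Fin N → Fin N → ℝ) :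
    Measure (Fin N → ℝ) :=
  (Measure.pi fun _ : Fin N => μ₀).tilted fun x => β * interaction J x

/-- The partition function `z ↦ ∫ exp (z l·x) μ_β(dx)` of the Gibbs measure. -/
noncomputable def gibbsPartition {N : ℕ} (μ₀ : Measure ℝ) (β : ℝ) (J : Fin N → Fin N → ℝ)
    (l : Fin N → ℝ) (z : ℂ) : ℂ :=
  ∫ x, Complex.exp (z * ((∑ j, l j * x j : ℝ) : ℂ)) ∂(gibbsMeasure μ₀ β J)

/-- The partition functions of ferromagnetic spin systems in a magnetic field: those of the Ising
model, and those of systems whose spins are real-valued with a symmetric a priori distribution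
`μ₀` having all Gaussian exponential moments. No assumption is made on the zeros of the Fourier
transform of `μ₀`. -/
inductive IsPartitionFunction : (ℂ → ℂ) → Prop
  | ising {N : ℕ} (J : Fin N → Fin N → ℝ) (l : Fin N → ℝ)
      (hJ : ∀ j k, 0 ≤ J j k) (hJs : ∀ j k, J j k = J k j) (hl : ∀ j, 0 ≤ l j) :
      IsPartitionFunction (isingPartition J l)
  | gibbs {N : ℕ} (μ₀ : Measure ℝ) (hprob : IsProbabilityMeasure μ₀)
      (hsymm : μ₀.map (fun x => -x) = μ₀)
      (hexp : ∀ b : ℝ, Integrable (fun x : ℝ => Real.exp (b * x ^ 2)) μ₀)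
      (β : ℝ) (hβ : 0 ≤ β) (J : Fin N → Fin N → ℝ) (l : Fin N → ℝ)
      (hJ : ∀ j k, 0 ≤ J j k) (hJs : ∀ j k, J j k = J k j) (hl : ∀ j, 0 ≤ l j) :
      IsPartitionFunction (gibbsPartition μ₀ β J l)

/-- The Lee-Yang property: an entire function whose zeros are all purely imaginary. -/
def HasLeeYangProperty (P : ℂ → ℂ) : Prop :=
  Differentiable ℂ P ∧ ∀ z : ℂ, P z = 0 → z.re = 0

/-! `P` is the complex moment generating function of the real variable `X = l·x`, which is symmetric
with `E exp(bX²) < ∞` for all `b`. So `P(it)` is a characteristic function, hence positive definite,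
and only the Laguerre-Pólya condition on the even entire function `f(z) = P(iz)` is at stake.

If the zeros of `f` are real: Gaussian moments give `|f(z)| ≤ C exp(ε|z|²)` for every `ε > 0`.
Instead of a Hadamard product, divide `f` by the real-rooted polynomial `q` of its zeros in `|z| ≤
R`; the quotient is `exp h` there. By evenness `h` vanishes to order two at `0`, so
Borel-Carathéodory and Schwarz bound it by `8A(|z|/R)²`, where `exp A` bounds `f` on `|z| = 3R`. As
`A` can be taken `o(R²)`, `h → 0` and `q → f` locally uniformly (`mem_laguerrePolya_of_even`).

Conversely, moduli of real-rooted polynomials grow with `|Im z|`, and so do those of their limits. A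
nonreal zero thus forces zeros on a whole vertical segment, hence `φ = 0`
(`LaguerrePolya.im_eq_zero`). -/

/-! ### Real-rooted polynomial approximation of even entire functions -/

/-- An even entire function vanishing at `a ≠ 0` is divisible by `1 - z² / a²`, with an even entire
quotient. -/
lemma exists_even_quotient {g : ℂ → ℂ} (hg : Differentiable ℂ g) (hge : ∀ z, g (-z) = g z)
    {a : ℂ} (ha : a ≠ 0) (hga : g a = 0) :
    ∃ k : ℂ → ℂ, Differentiable ℂ k ∧ (∀ z, k (-z) = k z) ∧
      ∀ z, g z = (1 - (a ^ 2)⁻¹ * z ^ 2) * k z := by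
  have differentiable_dslope {f : ℂ → ℂ} (hf : Differentiable ℂ f) (c : ℂ) :
      Differentiable ℂ (dslope f c) := by
    rw [← differentiableOn_univ] at hf ⊢
    exact (Complex.differentiableOn_dslope univ_mem).2 hf
  set d := dslope g a
  have h1 : ∀ z, g z = (z - a) * d z := fun z => by
    have := sub_smul_dslope g a z
    rw [hga, sub_zero, smul_eq_mul] at this
    exact this.symm
  have hda : d (-a) = 0 := by
    have h := h1 (-a)
    rw [hge, hga] at h
    have h2 : -a - a ≠ 0 := by
      intro h3
      apply ha
      linear_combination (-1 / 2) * h3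
    exact (mul_eq_zero.1 h.symm).resolve_left h2
  set e := dslope d (-a)
  have h2 : ∀ z, d z = (z + a) * e z := fun z => by
    have := sub_smul_dslope d (-a) z
    rw [hda, sub_zero, smul_eq_mul, sub_neg_eq_add] at this
    exact this.symm
  have hed : Differentiable ℂ e := differentiable_dslope (differentiable_dslope hg a) (-a)
  have h3 : ∀ z, g z = (z ^ 2 - a ^ 2) * e z := fun z => by
    rw [h1, h2]
    ring
  have hee : (fun z => e (-z)) = e := by
    -- Evenness of `e` is clear off `±a`; continuity extends it.
    refine Continuous.ext_on (s := ({a, -a} : Set ℂ)ᶜ)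
      ((Set.toFinite _).countable.dense_compl ℂ) (hed.continuous.comp continuous_neg)
      hed.continuous fun z hz => ?_
    have hz' : z ^ 2 - a ^ 2 ≠ 0 := by
      intro h
      apply hz
      have : (z - a) * (z + a) = 0 := by linear_combination h
      rcases mul_eq_zero.1 this with h | h
      · exact Or.inl (sub_eq_zero.1 h)
      · exact Or.inr (eq_neg_of_add_eq_zero_left h)
    have h := hge z
    rw [h3, h3, neg_sq] at h
    exact mul_left_cancel₀ hz' h
  refine ⟨fun z => -a ^ 2 * e z, hed.const_mul _, fun z => congrArg (-a ^ 2 * ·) (congrFun hee z), fun z => ?_⟩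
  rw [h3]
  field_simp
  ring

/-- Dividing out the zeros in a closed ball of an even entire function with real zeros only. The
quotient is bounded by the function on the sphere of three times the radius. -/
lemma exists_even_factorization {f : ℂ → ℂ} (hf : Differentiable ℂ f) (hfe : ∀ z, f (-z) = f z)
    (hf0 : f 0 = 1) (hfz : ∀ z, f z = 0 → z.im = 0) {R : ℝ} (hR : 0 < R) :
    ∃ (q : ℝ[X]) (g : ℂ → ℂ), (∀ z : ℂ, aeval z q = 0 → z.im = 0) ∧ Differentiable ℂ g ∧
      (∀ z, g (-z) = g z) ∧ g 0 = 1 ∧ (∀ z, f z = aeval z q * g z) ∧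
      (∀ z ∈ Metric.closedBall (0 : ℂ) R, g z ≠ 0) ∧
      ∀ z ∈ Metric.sphere (0 : ℂ) (3 * R), 1 ≤ ‖(aeval z q : ℂ)‖ := by
  -- `n` counts the factors `1 - z²/a²` removed. For `|a| ≤ R` and `|z| = 3R` each has modulus at
  -- least `9 - 1 = 8`. Since `g 0 = 1`, the maximum principle gives `8 ^ n ≤ M`, so the division
  -- stops.
  let Q : ℕ → ℝ[X] → (ℂ → ℂ) → Prop := fun n q g =>
    (∀ z : ℂ, aeval z q = 0 → z.im = 0) ∧ Differentiable ℂ g ∧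
      (∀ z, g (-z) = g z) ∧ g 0 = 1 ∧ (∀ z, f z = aeval z q * g z) ∧
      ∀ z ∈ Metric.sphere (0 : ℂ) (3 * R), (8 : ℝ) ^ n ≤ ‖(aeval z q : ℂ)‖
  have hQ0 : ∃ q g, Q 0 q g :=
    ⟨1, f, by simp, hf, hfe, hf0, by simp, by simp⟩
  obtain ⟨M, hM⟩ : ∃ M, ∀ z ∈ Metric.sphere (0 : ℂ) (3 * R), ‖f z‖ ≤ M :=
    (isCompact_sphere 0 (3 * R)).exists_bound_of_continuousOn hf.continuous.continuousOn
  have hbound : ∀ n q g, Q n q g → (8 : ℝ) ^ n ≤ M := by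
    rintro n q g ⟨-, hgd, -, hg0, hfg, hq⟩
    have h8 : (0 : ℝ) < 8 ^ n := by positivity
    have := Complex.norm_le_of_forall_mem_frontier_norm_le (U := Metric.ball (0 : ℂ) (3 * R))
      Metric.isBounded_ball hgd.diffContOnCl (C := M / 8 ^ n) (fun z hz => by
        rw [frontier_ball _ (by positivity)] at hz
        rw [le_div_iff₀ h8]
        calc ‖g z‖ * 8 ^ n ≤ ‖g z‖ * ‖(aeval z q : ℂ)‖ := by gcongr; exact hq z hz
          _ = ‖f z‖ := by rw [hfg, norm_mul, mul_comm]
          _ ≤ M := hM z hz) (subset_closure (Metric.mem_ball_self (by positivity)))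
    rwa [hg0, norm_one, le_div_iff₀ h8, one_mul] at this
  obtain ⟨n, ⟨q, g, hqg⟩, hn⟩ : ∃ n, (∃ q g, Q n q g) ∧ ¬ ∃ q g, Q (n + 1) q g := by
    by_contra! h
    have hall : ∀ n, ∃ q g, Q n q g := by
      intro n
      induction n with
      | zero => exact hQ0
      | succ n ih => exact h n ih
    obtain ⟨n, hn⟩ := pow_unbounded_of_one_lt M (by norm_num : (1 : ℝ) < 8)
    obtain ⟨q, g, hqg⟩ := hall n
    exact absurd (hbound n q g hqg) (not_le.2 hn)
  obtain ⟨hqz, hgd, hge, hg0, hfg, hq⟩ := hqg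
  refine ⟨q, g, hqz, hgd, hge, hg0, hfg, fun a haR hga => hn ?_,
    fun z hz => (one_le_pow₀ (by norm_num)).trans (hq z hz)⟩
  have ha : a ≠ 0 := by
    rintro rfl
    simp [hg0] at hga
  obtain ⟨k, hkd, hke, hgk⟩ := exists_even_quotient hgd hge ha hga
  -- The zero is real, so the new factor has real coefficients.
  have hare : a = (a.re : ℂ) := by
    have := hfz a (by rw [hfg, hga, mul_zero])
    apply Complex.ext <;> simp [this]
  have haev : ∀ z : ℂ, aeval z (q * (1 - C (a.re ^ 2)⁻¹ * X ^ 2)) =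
      aeval z q * (1 - (a ^ 2)⁻¹ * z ^ 2) := by
    intro z
    rw [hare]
    simp
  refine ⟨q * (1 - C (a.re ^ 2)⁻¹ * X ^ 2), k, fun z hz => ?_, hkd, hke, ?_, fun z => ?_,
    fun z hz => ?_⟩
  · rw [haev] at hz
    rcases mul_eq_zero.1 hz with h | h
    · exact hqz z h
    · apply hfz z
      rw [hfg, hgk, h, zero_mul, mul_zero]
  · have := hgk 0
    rw [hg0] at this
    simpa using this.symm
  · rw [haev, hfg, hgk, mul_assoc]
  · rw [haev, norm_mul, pow_succ]
    have h1 : (8 : ℝ) ≤ ‖1 - (a ^ 2)⁻¹ * z ^ 2‖ := by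
      have h2 : (9 : ℝ) ≤ ‖(a ^ 2)⁻¹ * z ^ 2‖ := by
        rw [mem_sphere_zero_iff_norm] at hz
        rw [mem_closedBall_zero_iff] at haR
        have hapos : 0 < ‖a‖ := norm_pos_iff.2 ha
        rw [norm_mul, norm_inv, norm_pow, norm_pow, hz, inv_mul_eq_div, le_div_iff₀ (by positivity)]
        nlinarith
      have := norm_sub_norm_le ((a ^ 2)⁻¹ * z ^ 2) 1
      rw [norm_one, norm_sub_rev] at this
      linarith
    gcongr
    exact hq z hz

/-- A zero-free even holomorphic function is the exponential of a function which vanishes to second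
order at the origin, and is quadratically small there if its real part is bounded above. -/
lemma exists_log_quadratic_bound {g : ℂ → ℂ} (hg : Differentiable ℂ g) (hge : ∀ z, g (-z) = g z)
    (hg0 : g 0 = 1) {R : ℝ} (hR : 0 < R) (hgz : ∀ z ∈ Metric.ball (0 : ℂ) R, g z ≠ 0) :
    ∃ h : ℂ → ℂ, (∀ z ∈ Metric.ball (0 : ℂ) R, g z = Complex.exp (h z)) ∧
      ∀ A > 0, (∀ z ∈ Metric.ball (0 : ℂ) R, ‖g z‖ ≤ Real.exp A) →
        ∀ z ∈ Metric.ball (0 : ℂ) (R / 2), ‖h z‖ ≤ 8 * A * (‖z‖ / R) ^ 2 := by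
  have hdd : Differentiable ℂ (deriv g) := fun z =>
    (hg.analyticAt z).deriv.differentiableAt
  have hex : Complex.IsExactOn (fun z => deriv g z / g z) (Metric.ball 0 R) :=
    DifferentiableOn.isExactOn_ball (hdd.differentiableOn.div hg.differentiableOn hgz)
  obtain ⟨h, hh0, hh⟩ := hex.with_val_at 0 0
  have hmem : (0 : ℂ) ∈ Metric.ball (0 : ℂ) R := Metric.mem_ball_self hR
  have hexp : ∀ z ∈ Metric.ball (0 : ℂ) R, g z = Complex.exp (h z) := by
    have hder : ∀ z ∈ Metric.ball (0 : ℂ) R,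
        HasDerivAt (fun z => g z * Complex.exp (-h z)) 0 z := by
      intro z hz
      have := (hg z).hasDerivAt.mul (hh z hz).neg.cexp
      convert! this using 1
      have := hgz z hz
      field_simp
      ring
    intro z hz
    have := (Metric.isOpen_ball).is_const_of_deriv_eq_zero
      (convex_ball (0 : ℂ) R).isPreconnected
      (fun z hz => (hder z hz).differentiableAt.differentiableWithinAt)
      (fun z hz => (hder z hz).deriv) hz hmem
    simp only [hh0, hg0, neg_zero, Complex.exp_zero, mul_one] at this
    rw [Complex.exp_neg] at this
    field_simp at this
    exact this
  refine ⟨h, hexp, fun A hA hgA z hz => ?_⟩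
  have hdo : DifferentiableOn ℂ h (Metric.ball 0 R) := fun z hz =>
    (hh z hz).differentiableAt.differentiableWithinAt
  have hre : Set.MapsTo h (Metric.ball 0 R) {z | z.re ≤ A} := by
    intro z hz
    have := hgA z hz
    rw [hexp z hz, Complex.norm_exp, Real.exp_le_exp] at this
    exact this
  have hsub : Metric.ball (0 : ℂ) (R / 2) ⊆ Metric.ball 0 R :=
    Metric.ball_subset_ball (by linarith)
  -- Borel-Carathéodory: `2A|w| / (R - |w|) ≤ 2A` when `|w| < R/2`.
  have hmaps : Set.MapsTo h (Metric.ball 0 (R / 2)) (Metric.closedBall (h 0) (2 * A)) := by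
    intro w hw
    have hb := Complex.borelCaratheodory_zero hA hdo hre hR (hsub hw) hh0
    rw [mem_ball_zero_iff] at hw
    rw [hh0, mem_closedBall_zero_iff]
    refine hb.trans ?_
    rw [div_le_iff₀ (by linarith)]
    nlinarith
  -- Evenness kills `g'(0)`, hence `h'(0)`. The second-order Schwarz lemma then gives
  -- `2A(|z|/(R/2))² = 8A(|z|/R)²`.
  have hderiv0 : deriv g 0 = 0 := by
    have h1 : deriv (fun z => g (-z)) 0 = deriv g 0 := by
      congr 1
      exact funext hge
    rw [deriv_comp_neg, neg_zero] at h1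
    linear_combination (-1 / 2) * h1
  have hlittle : (fun w => h w - h 0) =o[𝓝 0] fun w => ‖w - 0‖ ^ 1 := by
    have := (hh 0 hmem).isLittleO
    simpa [hderiv0] using this.norm_right
  have := Complex.dist_le_mul_div_pow_of_mapsTo_ball_of_isLittleO (hdo.mono hsub) hmaps hlittle hz
  rw [hh0, dist_zero_right, dist_zero_right] at this
  refine this.trans (le_of_eq ?_)
  ring

/-- An even entire function with real zeros only is close on a ball to a real polynomial with real
zeros only, up to an error controlled by its size on a much larger sphere. -/
lemma exists_polynomial_mul_exp {f : ℂ → ℂ} (hf : Differentiable ℂ f) (hfe : ∀ z, f (-z) = f z)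
    (hf0 : f 0 = 1) (hfz : ∀ z, f z = 0 → z.im = 0) {R : ℝ} (hR : 0 < R) :
    ∃ (q : ℝ[X]) (h : ℂ → ℂ), (∀ z : ℂ, aeval z q = 0 → z.im = 0) ∧
      (∀ z ∈ Metric.ball (0 : ℂ) R, f z = aeval z q * Complex.exp (h z)) ∧
      ∀ A > 0, (∀ z ∈ Metric.sphere (0 : ℂ) (3 * R), ‖f z‖ ≤ Real.exp A) →
        ∀ z ∈ Metric.ball (0 : ℂ) (R / 2), ‖h z‖ ≤ 8 * A * (‖z‖ / R) ^ 2 := by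
  obtain ⟨q, g, hq, hgd, hge, hg0, hfg, hgz, hq1⟩ := exists_even_factorization hf hfe hf0 hfz hR
  obtain ⟨h, hexp, hbd⟩ := exists_log_quadratic_bound hgd hge hg0 hR
    fun z hz => hgz z (Metric.ball_subset_closedBall hz)
  refine ⟨q, h, hq, fun z hz => by rw [hfg, hexp z hz], fun A hA hfA => hbd A hA fun z hz => ?_⟩
  refine Complex.norm_le_of_forall_mem_frontier_norm_le (U := Metric.ball (0 : ℂ) (3 * R))
    Metric.isBounded_ball hgd.diffContOnCl (fun w hw => ?_)
    (subset_closure (Metric.ball_subset_ball (by linarith) hz))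
  rw [frontier_ball _ (by positivity)] at hw
  calc ‖g w‖ ≤ ‖(aeval w q : ℂ)‖ * ‖g w‖ := le_mul_of_one_le_left (norm_nonneg _) (hq1 w hw)
    _ = ‖f w‖ := by rw [hfg, norm_mul]
    _ ≤ Real.exp A := hfA w hw

/-- An even entire function of growth at most order two and minimal type, with real zeros only,
belongs to the Laguerre-Pólya class. -/
theorem mem_laguerrePolya_of_even {f : ℂ → ℂ} (hf : Differentiable ℂ f)
    (hfe : ∀ z, f (-z) = f z) (hf0 : f 0 = 1) (hfz : ∀ z, f z = 0 → z.im = 0)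
    (hgrowth : ∀ ε > 0, ∃ C : ℝ, ∀ z, ‖f z‖ ≤ C * Real.exp (ε * ‖z‖ ^ 2)) :
    f ∈ LaguerrePolya := by
  choose p h hp hph hh using fun n : ℕ =>
    exists_polynomial_mul_exp hf hfe hf0 hfz (R := (n : ℝ) + 1) (by positivity)
  refine ⟨hf, p, hp, Metric.tendstoLocallyUniformly_iff.2 fun ε hε x => ?_⟩
  set r := ‖x‖ + 1
  have hr0 : 0 < r := by positivity
  have hxr : x ∈ Metric.ball (0 : ℂ) r := by
    rw [mem_ball_zero_iff]
    exact lt_add_one _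
  refine ⟨Metric.ball 0 r, Metric.isOpen_ball.mem_nhds hxr, ?_⟩
  obtain ⟨B', hB'⟩ : ∃ B, ∀ z ∈ Metric.closedBall (0 : ℂ) r, ‖f z‖ ≤ B :=
    (isCompact_closedBall 0 r).exists_bound_of_continuousOn hf.continuous.continuousOn
  set B := max B' 1
  have hB : ∀ z ∈ Metric.closedBall (0 : ℂ) r, ‖f z‖ ≤ B := fun z hz =>
    (hB' z hz).trans (le_max_left _ _)
  have hB1 : 1 ≤ B := le_max_right _ _
  have hB0 : 0 < B := by linarith
  -- `δ ≤ 1` allows `|exp w - 1| ≤ 2|w|` for `|w| ≤ δ`.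
  set δ := min 1 (ε / (4 * B))
  have hδ : 0 < δ := lt_min one_pos (by positivity)
  have hδ1 : δ ≤ 1 := min_le_left _ _
  have hδB : B * (2 * δ) < ε := by
    have : δ ≤ ε / (4 * B) := min_le_right _ _
    rw [le_div_iff₀ (by positivity)] at this
    nlinarith
  -- Chosen so that `8 · η(3R)² · (r/R)² = 72ηr² = δ/2`, whatever `R` is.
  set η := δ / (144 * r ^ 2)
  have hη : 0 < η := by positivity
  obtain ⟨C', hC'⟩ := hgrowth η hη
  set C := max C' 1
  have hC1 : 1 ≤ C := le_max_right _ _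
  have hC : ∀ z, ‖f z‖ ≤ C * Real.exp (η * ‖z‖ ^ 2) := fun z =>
    (hC' z).trans (by gcongr; exact le_max_left _ _)
  have hlim : Tendsto (fun n : ℕ => (n : ℝ) + 1) atTop atTop :=
    tendsto_atTop_add_const_right _ _ tendsto_natCast_atTop_atTop
  have hlim2 : Tendsto (fun n : ℕ => ((n : ℝ) + 1) ^ 2) atTop atTop :=
    (tendsto_pow_atTop two_ne_zero).comp hlim
  filter_upwards [hlim.eventually_gt_atTop (2 * r),
    hlim2.eventually_ge_atTop (16 * r ^ 2 * Real.log C / δ)] with n hn1 hn2 y hy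
  set R := (n : ℝ) + 1
  have hR : 0 < R := by positivity
  have hyr : ‖y‖ < r := mem_ball_zero_iff.1 hy
  have hlogC : 0 ≤ Real.log C := Real.log_nonneg hC1
  have hhy : ‖h n y‖ ≤ δ := by
    have := hh n (Real.log C + η * (3 * R) ^ 2) (by positivity) (fun z hz => by
      rw [mem_sphere_zero_iff_norm] at hz
      refine (hC z).trans (le_of_eq ?_)
      rw [Real.exp_add, Real.exp_log (by linarith), hz]) y
      (mem_ball_zero_iff.2 (by linarith))
    refine this.trans ?_
    calc 8 * (Real.log C + η * (3 * R) ^ 2) * (‖y‖ / R) ^ 2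
        ≤ 8 * (Real.log C + η * (3 * R) ^ 2) * (r / R) ^ 2 := by gcongr
      _ = 8 * r ^ 2 * Real.log C / R ^ 2 + δ / 2 := by
          simp only [η]
          field_simp
          ring
      _ ≤ δ / 2 + δ / 2 := by
          rw [div_le_iff₀ hδ] at hn2
          have : 8 * r ^ 2 * Real.log C / R ^ 2 ≤ δ / 2 := by
            rw [div_le_iff₀ (by positivity)]
            linarith
          linarith
      _ = δ := by ring
  have hpy : (aeval y (p n) : ℂ) = f y * Complex.exp (-h n y) := by
    rw [hph n y (mem_ball_zero_iff.2 (by linarith)), mul_assoc, ← Complex.exp_add,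
      add_neg_cancel, Complex.exp_zero, mul_one]
  rw [dist_comm, dist_eq_norm, hpy,
    show f y * Complex.exp (-h n y) - f y = f y * (Complex.exp (-h n y) - 1) by ring, norm_mul]
  have he := Complex.norm_exp_sub_one_le (x := -h n y) (by rw [norm_neg]; linarith)
  rw [norm_neg] at he
  calc ‖f y‖ * ‖Complex.exp (-h n y) - 1‖ ≤ B * (2 * δ) := by
        gcongr
        · exact hB y (Metric.ball_subset_closedBall hy)
        · linarith
    _ < ε := hδB

/-! ### Zeros of Laguerre-Pólya functions -/

/-- The modulus of a real polynomial with real zeros only increases on vertical half-lines starting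
on the real axis. -/
lemma norm_aeval_le_of_abs_im_le {p : ℝ[X]} (hp : ∀ z : ℂ, aeval z p = 0 → z.im = 0) {z w : ℂ}
    (hre : w.re = z.re) (him : |w.im| ≤ |z.im|) :
    ‖(aeval w p : ℂ)‖ ≤ ‖(aeval z p : ℂ)‖ := by
  have hs : (p.map (algebraMap ℝ ℂ)).Splits := IsAlgClosed.splits _
  have hp0 : p ≠ 0 := by
    rintro rfl
    simpa using hp Complex.I (by simp)
  have hnorm (z : ℂ) : ‖(aeval z p : ℂ)‖ = ‖algebraMap ℝ ℂ p.leadingCoeff‖ *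
      ((p.aroots ℂ).map fun a => ‖z - a‖).prod := by
    rw [hs.aeval_eq_prod_aroots, norm_mul]
    congr 1
    have := map_multiset_prod (normHom : ℂ →*₀ ℝ) ((p.aroots ℂ).map fun a => z - a)
    rw [Multiset.map_map] at this
    exact this
  rw [hnorm, hnorm]
  gcongr
  -- Factor by factor: for real `a`, `|z - a|² = (Re z - a)² + (Im z)²`.
  refine Multiset.prod_map_le_prod_map₀ _ _ (fun _ _ => norm_nonneg _) fun a ha => ?_
  have ha' : a.im = 0 := hp a ((mem_aroots.1 ha).2)
  rw [Complex.norm_eq_sqrt_sq_add_sq, Complex.norm_eq_sqrt_sq_add_sq]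
  simp only [Complex.sub_re, Complex.sub_im, ha', sub_zero, hre]
  gcongr 1
  gcongr 1
  exact sq_le_sq.2 him

/-- A function of the Laguerre-Pólya class which is not identically zero has real zeros only. -/
theorem LaguerrePolya.im_eq_zero {φ : ℂ → ℂ} (hφ : φ ∈ LaguerrePolya) (hne : φ ≠ 0) {z : ℂ}
    (hz : φ z = 0) : z.im = 0 := by
  obtain ⟨hd, p, hp, hlim⟩ := hφ
  have hmono : ∀ w : ℂ, w.re = z.re → |w.im| ≤ |z.im| → φ w = 0 := by
    intro w hre him
    have hpt (u : ℂ) := (tendstoLocallyUniformlyOn_univ.2 hlim).tendsto_at (Set.mem_univ u)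
    have h := le_of_tendsto_of_tendsto' (hpt w).norm (hpt z).norm fun n => norm_aeval_le_of_abs_im_le (hp n) hre him
    rw [hz, norm_zero] at h
    exact norm_le_zero_iff.1 h
  by_contra him
  have him' : 0 < |z.im| := abs_pos.2 him
  refine hne (AnalyticOnNhd.eq_of_frequently_eq (z₀ := (z.re : ℂ)) (fun w _ => hd.analyticAt w)
    (fun w _ => analyticAt_const) ?_)
  -- The zeros on the vertical segment through `z.re` accumulate at `z.re`.
  have ht : Tendsto (fun t : ℝ => (z.re : ℂ) + t * Complex.I) (𝓝[≠] 0) (𝓝[≠] (z.re : ℂ)) := by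
    refine tendsto_nhdsWithin_iff.2 ⟨?_, ?_⟩
    · have : Continuous fun t : ℝ => (z.re : ℂ) + t * Complex.I := by fun_prop
      simpa using this.continuousWithinAt.tendsto (x := (0 : ℝ)) (s := {0}ᶜ)
    · filter_upwards [self_mem_nhdsWithin] with t ht
      simpa using ht
  refine ht.frequently (Eventually.frequently ?_)
  have hnear : ∀ᶠ t : ℝ in 𝓝[≠] 0, |t| < |z.im| := by
    refine eventually_nhdsWithin_of_eventually_nhds ?_
    have : Continuous fun t : ℝ => |t| := continuous_abs
    exact this.continuousAt.eventually_lt continuousAt_const (by simpa using him')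
  filter_upwards [hnear] with t ht
  exact hmono _ (by simp) (by simpa using ht.le)

/-! ### Characteristic functions and Gaussian moments -/

/-- The characteristic function of a finite measure on the real line is positive definite. -/
lemma isPosDefFun_charFun (ν : Measure ℝ) [IsFiniteMeasure ν] : IsPosDefFun (charFun ν) := by
  intro n t c
  have hint (s : ℝ) : Integrable (fun y : ℝ => Complex.exp (s * y * Complex.I)) ν := by
    refine (integrable_const (1 : ℝ)).mono' (by fun_prop) (ae_of_all _ fun y => ?_)
    rw [← Complex.ofReal_mul, Complex.norm_exp_ofReal_mul_I]
  have hsum : ∑ j, ∑ k, c j * (starRingEnd ℂ) (c k) * charFun ν (t j - t k) =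
      ((∫ y, ‖∑ j, c j * Complex.exp (t j * y * Complex.I)‖ ^ 2 ∂ν : ℝ) : ℂ) := by
    have hpt (y : ℝ) : ((‖∑ j, c j * Complex.exp (t j * y * Complex.I)‖ ^ 2 : ℝ) : ℂ) =
        ∑ j, ∑ k, c j * (starRingEnd ℂ) (c k) *
          Complex.exp ((t j - t k : ℝ) * y * Complex.I) := by
      rw [Complex.ofReal_pow, ← Complex.mul_conj', map_sum, Finset.sum_mul_sum]
      refine Finset.sum_congr rfl fun j _ => Finset.sum_congr rfl fun k _ => ?_
      rw [map_mul, ← Complex.exp_conj, mul_mul_mul_comm, ← Complex.exp_add]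
      congr 2
      simp only [map_mul, Complex.conj_ofReal, Complex.conj_I, Complex.ofReal_sub]
      ring
    rw [← integral_complex_ofReal]
    simp_rw [hpt]
    rw [integral_finsetSum _ fun j _ => integrable_finsetSum _ fun k _ =>
      (hint (t j - t k)).const_mul _]
    refine Finset.sum_congr rfl fun j _ => ?_
    rw [integral_finsetSum _ fun k _ => (hint (t j - t k)).const_mul _]
    refine Finset.sum_congr rfl fun k _ => ?_
    rw [integral_const_mul, charFun_apply_real]
  rw [hsum]
  exact ⟨by rw [Complex.ofReal_re]; positivity, Complex.ofReal_im _⟩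

section GaussianMoments

variable {ν : Measure ℝ} (hexp : ∀ b : ℝ, Integrable (fun y : ℝ => Real.exp (b * y ^ 2)) ν)
include hexp

lemma integrable_exp_mul_of_gaussian_moments [IsFiniteMeasure ν] (t : ℝ) :
    Integrable (fun y : ℝ => Real.exp (t * y)) ν := by
  refine ((hexp 1).const_mul (Real.exp (t ^ 2))).mono' (by fun_prop) (ae_of_all _ fun y => ?_)
  rw [Real.norm_eq_abs, Real.abs_exp, ← Real.exp_add, Real.exp_le_exp]
  nlinarith [sq_nonneg (t - y), sq_nonneg t, sq_nonneg y]

lemma differentiable_complexMGF_of_gaussian_moments [IsFiniteMeasure ν] :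
    Differentiable ℂ (ProbabilityTheory.complexMGF id ν) := by
  have huniv : ProbabilityTheory.integrableExpSet id ν = Set.univ :=
    Set.eq_univ_of_forall fun t => integrable_exp_mul_of_gaussian_moments hexp t
  intro z
  exact (ProbabilityTheory.hasDerivAt_complexMGF (by simp [huniv])).differentiableAt

/-- Young's inequality `y Re z ≤ y²/(4ε) + ε(Re z)²`, integrated in `y`. Arbitrary `ε` means minimal
type at order two. -/
lemma exists_norm_complexMGF_le_of_gaussian_moments [IsFiniteMeasure ν] {ε : ℝ} (hε : 0 < ε) :
    ∃ C : ℝ, ∀ z, ‖ProbabilityTheory.complexMGF id ν z‖ ≤ C * Real.exp (ε * ‖z‖ ^ 2) := by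
  refine ⟨∫ y, Real.exp ((4 * ε)⁻¹ * y ^ 2) ∂ν, fun z => ?_⟩
  refine ProbabilityTheory.norm_complexMGF_le_mgf.trans ?_
  rw [ProbabilityTheory.mgf, ← integral_mul_const]
  refine integral_mono (integrable_exp_mul_of_gaussian_moments hexp _) ((hexp _).mul_const _)
    fun y => ?_
  simp only [id_eq]
  rw [← Real.exp_add, Real.exp_le_exp]
  have h1 : z.re ^ 2 ≤ ‖z‖ ^ 2 := sq_le_sq.2 (by simpa using Complex.abs_re_le_norm z)
  have h2 : (4 * ε)⁻¹ * y ^ 2 + ε * z.re ^ 2 - z.re * y = (4 * ε)⁻¹ * (y - 2 * ε * z.re) ^ 2 := by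
    field_simp
    ring
  have h3 : 0 ≤ (4 * ε)⁻¹ * (y - 2 * ε * z.re) ^ 2 := by positivity
  nlinarith [mul_le_mul_of_nonneg_left h1 hε.le]

/-- For a probability measure with all Gaussian exponential moments and an even moment generating
function, the Lee-Yang property means that the characteristic function is in the Lukacs class. -/
theorem hasLeeYangProperty_complexMGF_iff [IsProbabilityMeasure ν]
    (heven : ∀ z, ProbabilityTheory.complexMGF id ν (-z) = ProbabilityTheory.complexMGF id ν z) :
    HasLeeYangProperty (ProbabilityTheory.complexMGF id ν) ↔
      (fun t : ℝ => ProbabilityTheory.complexMGF id ν (Complex.I * (t : ℂ))) ∈ LukacsClass := by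
  set P := ProbabilityTheory.complexMGF id ν with hP
  have hd : Differentiable ℂ P := differentiable_complexMGF_of_gaussian_moments hexp
  have hdI : Differentiable ℂ fun z => P (Complex.I * z) :=
    hd.comp (differentiable_id.const_mul Complex.I)
  have hP0 : P 0 = 1 := by simp [hP, ProbabilityTheory.complexMGF]
  constructor
  · rintro ⟨-, hz⟩
    have hchar : (fun t : ℝ => P (Complex.I * (t : ℂ))) = charFun ν := by
      funext t
      rw [mul_comm, hP, ProbabilityTheory.complexMGF_id_mul_I]
    refine ⟨?_, fun z => P (Complex.I * z), ⟨mem_laguerrePolya_of_even hdI ?_ ?_ ?_ ?_, ?_, ?_⟩,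
      fun t => rfl⟩
    · rw [hchar]
      exact ⟨continuous_charFun, ⟨1, norm_charFun_le_one⟩, isPosDefFun_charFun ν, by simp⟩
    · intro z
      rw [mul_neg, heven]
    · simp [hP0]
    · intro z h
      simpa using hz _ h
    · intro ε hε
      obtain ⟨C, hC⟩ := exists_norm_complexMGF_le_of_gaussian_moments hexp hε
      exact ⟨C, fun z => by simpa using hC (Complex.I * z)⟩
    · intro z
      simp only [mul_neg, heven]
    · simp [hP0]
  · rintro ⟨-, φ, ⟨hφ, -, hφ0⟩, hφt⟩
    refine ⟨hd, fun z hz => ?_⟩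
    -- Membership only gives agreement on the real axis; the identity theorem does the rest.
    have heq : φ = fun z => P (Complex.I * z) := by
      refine AnalyticOnNhd.eq_of_frequently_eq (z₀ := 0) (fun w _ => hφ.1.analyticAt w)
        (fun w _ => hdI.analyticAt w) ?_
      have ht : Tendsto (fun t : ℝ => (t : ℂ)) (𝓝[≠] 0) (𝓝[≠] 0) := by
        refine tendsto_nhdsWithin_iff.2 ⟨?_, ?_⟩
        · exact (Complex.continuous_ofReal.tendsto' 0 0 Complex.ofReal_zero).mono_left
            nhdsWithin_le_nhds
        · filter_upwards [self_mem_nhdsWithin] with t ht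
          simpa using ht
      exact ht.frequently (Eventually.of_forall hφt).frequently
    have hne : φ ≠ 0 := by
      rintro rfl
      simp at hφ0
    have := LaguerrePolya.im_eq_zero hφ hne (z := -Complex.I * z) (by
      rw [heq]
      dsimp only
      rw [← mul_assoc, mul_neg, Complex.I_mul_I, neg_neg, one_mul, hz])
    simpa using this

end GaussianMoments

/-! ### Real-valued spins -/

lemma measurable_interaction {N : ℕ} (A : Fin N → Fin N → ℝ) : Measurable (interaction A) := by
  unfold interaction
  fun_prop

/-- A diagonal bound makes the exponential a product of one-variable functions, integrable for the
product measure. -/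
lemma interaction_le {N : ℕ} (A : Fin N → Fin N → ℝ) (x : Fin N → ℝ) :
    interaction A x ≤ ∑ i, (∑ j, ∑ k, |A j k|) * x i ^ 2 := by
  rw [← Finset.mul_sum, Finset.sum_mul]
  refine Finset.sum_le_sum fun j _ => ?_
  rw [Finset.sum_mul]
  refine Finset.sum_le_sum fun k _ => ?_
  have hle (i : Fin N) : x i ^ 2 ≤ ∑ i, x i ^ 2 :=
    Finset.single_le_sum (f := fun i => x i ^ 2) (fun i _ => sq_nonneg _) (Finset.mem_univ i)
  calc A j k * x j * x k ≤ |A j k * x j * x k| := le_abs_self _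
    _ = |A j k| * (|x j| * |x k|) := by rw [abs_mul, abs_mul, mul_assoc]
    _ ≤ |A j k| * ∑ i, x i ^ 2 := by
      gcongr
      have h1 := hle j
      have h2 := hle k
      rw [← sq_abs] at h1 h2
      nlinarith [sq_nonneg (|x j| - |x k|)]

/-- Exponentials of quadratic forms are integrable for products of a measure with all Gaussian
exponential moments. -/
lemma integrable_exp_interaction {N : ℕ} {μ₀ : Measure ℝ} [IsProbabilityMeasure μ₀]
    (hexp : ∀ b : ℝ, Integrable (fun x : ℝ => Real.exp (b * x ^ 2)) μ₀)
    (A : Fin N → Fin N → ℝ) :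
    Integrable (fun x => Real.exp (interaction A x)) (Measure.pi fun _ : Fin N => μ₀) := by
  refine (Integrable.fintype_prod (μ := fun _ : Fin N => μ₀)
    fun _ => hexp (∑ j, ∑ k, |A j k|)).mono'
    (measurable_interaction A).exp.aestronglyMeasurable (ae_of_all _ fun x => ?_)
  rw [Real.norm_eq_abs, Real.abs_exp, ← Real.exp_sum, Real.exp_le_exp]
  exact interaction_le A x

lemma interaction_neg {N : ℕ} (A : Fin N → Fin N → ℝ) (x : Fin N → ℝ) :
    interaction A (-x) = interaction A x := by
  simp [interaction]

lemma sq_sum_eq_interaction {N : ℕ} (l x : Fin N → ℝ) :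
    (∑ j, l j * x j) ^ 2 = interaction (fun j k => l j * l k) x := by
  rw [sq, Finset.sum_mul_sum, interaction]
  refine Finset.sum_congr rfl fun j _ => Finset.sum_congr rfl fun k _ => ?_
  ring

section Gibbs

variable {N : ℕ} {μ₀ : Measure ℝ} [IsProbabilityMeasure μ₀]
    (hexp : ∀ b : ℝ, Integrable (fun x : ℝ => Real.exp (b * x ^ 2)) μ₀)
    (β : ℝ) (J : Fin N → Fin N → ℝ) (l : Fin N → ℝ)

include hexp in
lemma integrable_exp_mul_interaction :
    Integrable (fun x => Real.exp (β * interaction J x)) (Measure.pi fun _ : Fin N => μ₀) := by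
  convert integrable_exp_interaction hexp (fun j k => β * J j k) using 3 with x
  simp only [interaction, Finset.mul_sum]
  refine Finset.sum_congr rfl fun j _ => Finset.sum_congr rfl fun k _ => ?_
  ring

include hexp in
lemma isProbabilityMeasure_gibbsMeasure : IsProbabilityMeasure (gibbsMeasure μ₀ β J) :=
  isProbabilityMeasure_tilted (integrable_exp_mul_interaction hexp β J)

include hexp in
lemma integrable_exp_sq_gibbsMeasure (b : ℝ) :
    Integrable (fun x => Real.exp (b * (∑ j, l j * x j) ^ 2)) (gibbsMeasure μ₀ β J) := by
  rw [gibbsMeasure, integrable_tilted_iff (integrable_exp_mul_interaction hexp β J)]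
  -- `(l·x)²` is itself a quadratic form, so the Gibbs density times `exp(b(l·x)²)` is, up to
  -- normalization, the exponential of a single one.
  convert integrable_exp_interaction hexp (fun j k => β * J j k + b * (l j * l k)) using 2 with x
  rw [smul_eq_mul, ← Real.exp_add, sq_sum_eq_interaction]
  congr 1
  simp only [interaction, Finset.mul_sum, ← Finset.sum_add_distrib]
  refine Finset.sum_congr rfl fun j _ => Finset.sum_congr rfl fun k _ => ?_
  ring

lemma gibbsPartition_neg (hsymm : μ₀.map (fun x => -x) = μ₀) (z : ℂ) :
    gibbsPartition μ₀ β J l (-z) = gibbsPartition μ₀ β J l z := by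
  have : μ₀.IsNegInvariant := ⟨hsymm⟩
  simp only [gibbsPartition, gibbsMeasure, integral_tilted]
  rw [← integral_neg_eq_self]
  refine integral_congr_ae (ae_of_all _ fun x => ?_)
  simp [interaction_neg]

end Gibbs

lemma gibbsPartition_eq_complexMGF {N : ℕ} (μ₀ : Measure ℝ) (β : ℝ) (J : Fin N → Fin N → ℝ)
    (l : Fin N → ℝ) :
    gibbsPartition μ₀ β J l = ProbabilityTheory.complexMGF id
      ((gibbsMeasure μ₀ β J).map fun x => ∑ j, l j * x j) := by
  have hmeas : Measurable fun x : Fin N → ℝ => ∑ j, l j * x j := by fun_prop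
  rw [ProbabilityTheory.complexMGF_id_map hmeas.aemeasurable]
  rfl

/-! ### Ising spins -/

section Ising

variable {N : ℕ} (J : Fin N → Fin N → ℝ) (l : Fin N → ℝ)

lemma spinVec_neg (s : Fin N → ℤˣ) : spinVec (-s) = -spinVec s := by
  funext j
  simp [spinVec]

lemma isingPartition_neg (z : ℂ) : isingPartition J l (-z) = isingPartition J l z := by
  unfold isingPartition
  -- Global spin flip, which preserves the energy.
  rw [← Equiv.sum_comp (Equiv.neg (Fin N → ℤˣ))]
  refine Finset.sum_congr rfl fun s _ => ?_
  simp [isingWeight, spinVec_neg, interaction_neg]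

lemma sum_exp_interaction_pos :
    0 < ∑ s : Fin N → ℤˣ, Real.exp (interaction J (spinVec s)) :=
  Finset.sum_pos (fun _ _ => Real.exp_pos _) Finset.univ_nonempty

lemma isingWeight_nonneg (s : Fin N → ℤˣ) : 0 ≤ isingWeight J s :=
  mul_nonneg (inv_nonneg.2 (sum_exp_interaction_pos J).le) (Real.exp_pos _).le

lemma sum_isingWeight : ∑ s, isingWeight J s = 1 := by
  simp only [isingWeight, ← Finset.mul_sum]
  exact inv_mul_cancel₀ (sum_exp_interaction_pos J).ne'

/-- The law of the magnetization `l·x` under the Ising probability measure. -/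
noncomputable def isingLaw : Measure ℝ :=
  ∑ s : Fin N → ℤˣ, ENNReal.ofReal (isingWeight J s) • Measure.dirac (∑ j, l j * spinVec s j)

instance isProbabilityMeasure_isingLaw : IsProbabilityMeasure (isingLaw J l) := by
  constructor
  simp only [isingLaw, Measure.coe_finsetSum, Finset.sum_apply, Measure.smul_apply, measure_univ,
    smul_eq_mul, mul_one]
  rw [← ENNReal.ofReal_sum_of_nonneg fun s _ => isingWeight_nonneg J s, sum_isingWeight,
    ENNReal.ofReal_one]

lemma integrable_smul_dirac {E : Type*} [NormedAddCommGroup E] (f : ℝ → E) (s : Fin N → ℤˣ) :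
    Integrable f (ENNReal.ofReal (isingWeight J s) • Measure.dirac (∑ j, l j * spinVec s j)) :=
  (integrable_dirac enorm_lt_top).smul_measure ENNReal.ofReal_ne_top

lemma integrable_isingLaw {E : Type*} [NormedAddCommGroup E] (f : ℝ → E) :
    Integrable f (isingLaw J l) :=
  integrable_finsetSum_measure.2 fun s _ => integrable_smul_dirac J l f s

lemma isingPartition_eq_complexMGF :
    isingPartition J l = ProbabilityTheory.complexMGF id (isingLaw J l) := by
  funext z
  rw [ProbabilityTheory.complexMGF, isingLaw,
    integral_finsetSum_measure fun s _ => integrable_smul_dirac J l _ s, isingPartition]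
  refine Finset.sum_congr rfl fun s _ => ?_
  rw [integral_smul_measure, integral_dirac, ENNReal.toReal_ofReal (isingWeight_nonneg J s),
    Complex.real_smul, mul_comm]
  rfl

end Ising

theorem mainTheorem8 (P : ℂ → ℂ) (hP : IsPartitionFunction P) :
    HasLeeYangProperty P ↔ (fun t : ℝ => P (Complex.I * (t : ℂ))) ∈ LukacsClass := by
  cases hP with
  | ising J l hJ hJs hl =>
    have heven := isingPartition_neg J l
    rw [isingPartition_eq_complexMGF] at heven ⊢
    exact hasLeeYangProperty_complexMGF_iff (fun b => integrable_isingLaw J l _) heven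
  | gibbs μ₀ hprob hsymm hexp β hβ J l hJ hJs hl =>
    have heven := gibbsPartition_neg β J l hsymm
    have := isProbabilityMeasure_gibbsMeasure hexp β J
    have hmeas : Measurable fun x : Fin _ → ℝ => ∑ j, l j * x j := by fun_prop
    have := Measure.isProbabilityMeasure_map (μ := gibbsMeasure μ₀ β J) hmeas.aemeasurable
    rw [gibbsPartition_eq_complexMGF] at heven ⊢
    refine hasLeeYangProperty_complexMGF_iff (fun b => ?_) heven
    rw [integrable_map_measure (by fun_prop) hmeas.aemeasurable]
    exact integrable_exp_sq_gibbsMeasure hexp β J l b
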